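/- **Theorem 1.** Consider coded communication by coherent states over a noiseless optical channel with a Kennedy–Dolinar receiver. A code of block length $N$ with $M$ equiprobable messages over a finite alphabet $\mathcal X\subset\mathbb C$ maps each message $m$ to a codeword $(x_1(m),\dots,x_N(m))\in\mathcal X^N$, where a symbol of amplitude $x$ carries $|x|^2$ photons on average. During the $i$-th symbol the receiver applies a constant control amplitude $l_i=l_i(y_1,\dots,y_{i-1})\in\mathbb C$, which may depend arbitrarily on the earlier outputs, and it observes only whether at least one photon arrives ($y_i=1$, a click) or none does ($y_i=0$): $$\Pr(Y_i=0\mid X_i=x,\ Y_1^{i-1}=y_1^{i-1})=e^{-|x+l_i(y_1^{i-1})|^2},\qquad \Pr(Y_i=1\mid X_i=x,\ Y_1^{i-1}=y_1^{i-1})=1-e^{-|x+l_i(y_1^{i-1})|^2}.$$ The message is estimated from $Y_1,\dots,Y_N$. The mean-photon-number constraint is $\mathbb E[|X_i|^2]\le\mathcal E$ for every $i$, with respect to the uniform distribution on the messages. A rate $R$ (nats per symbol) is achievable if, for some finite alphabet, there are such codes for all large $N$ with $M\ge e^{NR}$ messages whose average error probability tends to $0$ as $N\to\infty$. Let $C_{\mathsf{coherent}}(\mathcal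 E)$ be the supremum of the achievable rates, and let $C_{\mathsf{DD}}(\mathcal E)$ be the supremum of the rates that are achievable by direct detection, i.e. with all control amplitudes $l_i=0$. Then $C_{\mathsf{coherent}}(\mathcal E)<\infty$ for all sufficiently small $\mathcal E>0$, and, as $\mathcal E\to0$, $$\frac{C_{\mathsf{coherent}}(\mathcal E)}{\mathcal E}\le\log\frac1{\mathcal E}-\log\log\frac1{\mathcal E}+O(1).$$ Direct detection matches this bound: $$\log\frac1{\mathcal E}-\log\log\frac1{\mathcal E}-O(1)\le\frac{C_{\mathsf{DD}}(\mathcal E)}{\mathcal E}\le\frac{C_{\mathsf{coherent}}(\mathcal E)}{\mathcal E},$$ so that $C_{\mathsf{coherent}}(\mathcal E)-C_{\mathsf{DD}}(\mathcal E)=O(\mathcal E)$: adaptive coherent feedback gives no gain in the first two terms of the capacity. -/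

import Mathlib

/-!
Coded communication over the (lossless, noise-free) optical channel with coherent-state inputs and
a Kennedy-Dolinar receiver.  Amplitudes are normalised by the symbol duration, so that a coherent
state of amplitude `x : ℂ` carries `‖x‖ ^ 2` photons on average.
-/

namespace KennedyDolinar

/-- The law of the click (`true`) / no-click (`false`) outcome of one symbol period, when the
transmitted amplitude is `x` and the control signal is `l` during the whole period.  The photon
counter sees a coherent state of amplitude `x + l`, so the number of photon arrivals is Poisson
with mean `‖x + l‖ ^ 2`; there is no click exactly when this number is zero. -/
noncomputable def clickProb (x l : ℂ) : Bool → ℝ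
  | false => Real.exp (-‖x + l‖ ^ 2)
  | true => 1 - Real.exp (-‖x + l‖ ^ 2)

/-- An adaptive control for `N` symbols: the (constant) control amplitude applied during symbol `i`
is an arbitrary function of the click / no-click outcomes of the symbols before `i`. -/
abbrev Control (N : ℕ) : Type := (i : Fin N) → (Fin i → Bool) → ℂ

/-- The outcomes that were observed before symbol `i`. -/
def past {N : ℕ} (y : Fin N → Bool) (i : Fin N) : Fin i → Bool :=
  fun j => y (Fin.castLE i.isLt.le j)

/-- The probability of the outcome sequence `y`, when the codeword `x` is transmitted and the
receiver uses the adaptive control `l`. -/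
noncomputable def outcomeProb {N : ℕ} (x : Fin N → ℂ) (l : Control N) (y : Fin N → Bool) : ℝ :=
  ∏ i, clickProb (x i) (l i (past y i)) (y i)

/-- A code with `M` messages and block length `N` over the alphabet `𝒳`, together with its
receiver: an encoder (without feedback from the receiver), an adaptive control, and a decoder,
which estimates the message from all the click / no-click outcomes. -/
structure Code (𝒳 : Finset ℂ) (N M : ℕ) where
  encode : Fin M → Fin N → ℂ
  encode_mem : ∀ m i, encode m i ∈ 𝒳
  control : Control N
  decode : (Fin N → Bool) → Fin M

namespace Code

variable {𝒳 : Finset ℂ} {N M : ℕ}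

/-- The mean photon number `𝔼[|X_i|^2]` of the `i`-th symbol, for equiprobable messages. -/
noncomputable def meanPhotons (c : Code 𝒳 N M) (i : Fin N) : ℝ :=
  (∑ m, ‖c.encode m i‖ ^ 2) / M

/-- The probability of a decoding error, for equiprobable messages. -/
noncomputable def errorProb (c : Code 𝒳 N M) : ℝ :=
  (∑ m, ∑ y ∈ Finset.univ.filter (fun y => c.decode y ≠ m),
    outcomeProb (c.encode m) c.control y) / M

/-- The receiver is a direct-detection receiver: no control signal is ever applied. -/
def IsDirect (c : Code 𝒳 N M) : Prop :=
  ∀ i h, c.control i h = 0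

end Code

/-- The rates `R` (nats per symbol) that are achievable with at most `E` photons per symbol on
average, by adaptive control: for some finite alphabet there are codes of every large block
length `N`, with at least `exp (N R)` messages, whose error probability tends to zero. -/
def coherentRates (E : ℝ) : Set ℝ :=
  {R | ∃ 𝒳 : Finset ℂ, ∀ ε > 0, ∀ᶠ N : ℕ in Filter.atTop, ∃ (M : ℕ) (c : Code 𝒳 N M),
    Real.exp (N * R) ≤ M ∧ (∀ i, c.meanPhotons i ≤ E) ∧ c.errorProb ≤ ε}

/-- The rates that are achievable in the same sense by direct detection. -/
def directRates (E : ℝ) : Set ℝ :=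
  {R | ∃ 𝒳 : Finset ℂ, ∀ ε > 0, ∀ᶠ N : ℕ in Filter.atTop, ∃ (M : ℕ) (c : Code 𝒳 N M),
    c.IsDirect ∧ Real.exp (N * R) ≤ M ∧ (∀ i, c.meanPhotons i ≤ E) ∧ c.errorProb ≤ ε}

/-- The capacity (nats per symbol) with the adaptive Kennedy-Dolinar receiver. -/
noncomputable def coherentCapacity (E : ℝ) : ℝ := sSup (coherentRates E)

/-- The capacity (nats per symbol) with direct detection. -/
noncomputable def directCapacity (E : ℝ) : ℝ := sSup (directRates E)

end KennedyDolinar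

/-!
Write `L = log (1 / E)`. Both bounds come down to single-symbol estimates.

**Upper bound.** Compare the outputs of a code with the law that the same adaptive receiver would
see if every symbol period contributed clicks with intensity `‖l‖ ^ 2 + E`, whatever the message
(`referenceControl`). The single-symbol estimate `sum_clickProb_mul_log_le` says that for *every*
control `l` the relative entropy of the click law of a symbol `x` with respect to this reference is
at most `O(E) + ‖x‖ ^ 2 (L - log L + O(1))`. Since this does not involve `l` and is affine in
`‖x‖ ^ 2`, the chain rule (`sum_outcomeProb_mul_log_le`) and the photon constraint bound the
message-averaged relative entropy by `N E (L - log L + O(1))`, and Fano's inequality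
(`one_sub_errorProb_mul_log_le`) turns this into a bound on `log M`. No concavity in the conditional
photon number is needed.

In the single-symbol estimate, with `a = ‖x‖` and `b = ‖l‖`, a control with `2 a ≤ b` makes the two
laws comparable, and a `χ²`-type bound gives `O(a ^ 2 + E)`; when `b ≤ 2 a`, the cross term `a b` is
only multiplied by `log (a / b)`, so it costs `O(a ^ 2)`, and what remains is
`(1 - exp (-a ^ 2)) (L + log (min 1 (a ^ 2)))`. Maximising this per photon puts `a ^ 2` near `1 / L`
and yields `L - log L + O(1)` (`one_sub_exp_neg_mul_log_le`).

**Lower bound.** That optimum is attained by on-off keying with pulses of energy `E B ≈ 1 / L` in one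
symbol out of `B`. Messages are pairs `(s, w)` with `s` in `ℤ / B`, and symbol `i` of `(s, w)` is a
pulse when `s + γ i w = 0` for random functions `γ i`; the shift `s` makes the photon constraint hold
exactly for every draw (`sum_messages_pulse`), while distinct messages share pulses at most
as often as independent ones (`mul_sum_pulse_mul_pulse_le`). The decoder picks a message whose
pulses cover all clicks. There are about `N p / B` clicks, with `p = 1 - exp (-E B)`, and each is
covered by a wrong message with probability at most `1 / B`, so all rates below `p / B * log B` are
achievable (`mem_directRates`).
-/

namespace KennedyDolinar

open Real

/-! ### Relative entropy of the click law -/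

theorem one_sub_exp_neg_le_mul (u : ℝ) (hu : 0 ≤ u) :
    1 - exp (-u) ≤ u * (1 - min 1 u / 4) := by
  rcases le_total u 2 with h2 | h2
  · -- Squaring `1 - u / 2 ≤ exp (-u / 2)` gives the quadratic term.
    have h1 : (1 - u / 2) ^ 2 ≤ exp (-u) := by
      have h := one_sub_le_exp_neg (u / 2)
      calc (1 - u / 2) ^ 2 ≤ exp (-(u / 2)) ^ 2 := by gcongr; linarith
        _ = exp (-u) := by rw [← exp_nat_mul]; congr 1; push_cast; ring
    have h3 : u * (min 1 u / 4) ≤ u * (u / 4) := by gcongr; exact min_le_right _ _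
    nlinarith
  · rw [min_eq_left (by linarith)]
    have := exp_pos (-u)
    linarith

theorem one_le_log_one_div {E : ℝ} (hE : 0 < E) (hE1 : E < exp (-1)) : 1 ≤ log (1 / E) := by
  rw [one_div, log_inv]
  have := (log_lt_log hE hE1).le
  rw [log_exp] at this
  linarith

theorem div_one_add_le_one_sub_exp_neg {t : ℝ} (ht : 0 ≤ t) : t / (1 + t) ≤ 1 - exp (-t) := by
  have h := add_one_le_exp t
  have h2 : exp (-t) ≤ 1 / (1 + t) := by
    rw [exp_neg, ← one_div]
    exact one_div_le_one_div_of_le (by linarith) (by linarith)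
  have h3 : t / (1 + t) = 1 - 1 / (1 + t) := by field_simp; ring
  linarith

/-- Relative entropy of the click law at intensity `s` with respect to the click law at
intensity `t`. -/
noncomputable def clickDiv (s t : ℝ) : ℝ :=
  (1 - exp (-s)) * log ((1 - exp (-s)) / (1 - exp (-t))) + exp (-s) * (t - s)

theorem exp_neg_mul_sub_le {s t μ : ℝ} (hs : μ ≤ s) (ht : μ ≤ t) :
    exp (-s) * (t - s) ≤ exp (-s) - exp (-t) + exp (-μ) * (t - s) ^ 2 := by
  have hes : exp (-s) ≤ exp (-μ) := exp_le_exp.2 (by linarith)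
  have het : exp (-t) ≤ exp (-μ) := exp_le_exp.2 (by linarith)
  rcases le_total s t with h | h
  · have hd : exp (-(t - s)) * (1 + (t - s)) ≤ 1 := by
      have := add_one_le_exp (t - s)
      calc exp (-(t - s)) * (1 + (t - s)) ≤ exp (-(t - s)) * exp (t - s) := by gcongr; linarith
        _ = 1 := by rw [← exp_add]; simp
    have h0 : exp (-t) = exp (-s) * exp (-(t - s)) := by rw [← exp_add]; congr 1; ring
    have h1 : (t - s) - 1 + exp (-(t - s)) ≤ (t - s) ^ 2 := by
      have := exp_pos (-(t - s))
      nlinarith [mul_nonneg this.le (sub_nonneg.2 h), pow_nonneg (sub_nonneg.2 h) 3]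
    have h2 := mul_le_mul_of_nonneg_left h1 (exp_pos (-s)).le
    have h3 := mul_le_mul_of_nonneg_right hes (sq_nonneg (t - s))
    rw [h0]
    linarith
  · have h0 : exp (-s) = exp (-t) * exp (t - s) := by rw [← exp_add]; congr 1; ring
    have h1 : exp (t - s) * (t - s - 1) + 1 ≤ (t - s) ^ 2 := by
      have := add_one_le_exp (t - s)
      nlinarith
    have h2 := mul_le_mul_of_nonneg_left h1 (exp_pos (-t)).le
    have h3 := mul_le_mul_of_nonneg_right het (sq_nonneg (t - s))
    rw [h0]
    linarith

theorem abs_exp_neg_sub_exp_neg_le {s t μ : ℝ} (hs : μ ≤ s) (ht : μ ≤ t) :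
    |exp (-s) - exp (-t)| ≤ exp (-μ) * |t - s| := by
  have key : ∀ a b : ℝ, μ ≤ a → a ≤ b → |exp (-a) - exp (-b)| ≤ exp (-μ) * |b - a| := by
    intro a b ha hab
    have h1 : exp (-b) ≤ exp (-a) := exp_le_exp.2 (by linarith)
    rw [abs_of_nonneg (by linarith), abs_of_nonneg (by linarith)]
    have h0 : exp (-b) = exp (-a) * exp (-(b - a)) := by rw [← exp_add]; congr 1; ring
    have h2 := one_sub_le_exp_neg (b - a)
    have h3 : exp (-a) ≤ exp (-μ) := exp_le_exp.2 (by linarith)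
    have h4 := mul_le_mul_of_nonneg_left h2 (exp_pos (-a)).le
    have h5 := mul_le_mul_of_nonneg_right h3 (sub_nonneg.2 hab)
    rw [h0]; linarith
  rcases le_total s t with h | h
  · exact key s t hs h
  · rw [abs_sub_comm, abs_sub_comm t]; exact key t s ht h

/-- A `χ²`-type bound. A lower bound `μ` on both intensities, of the order of `t` when `t` is large,
is what makes the constant uniform: the factor `1 + 2 t` is absorbed by `exp (-μ)`. -/
theorem clickDiv_le_sq_div {s t μ : ℝ} (hμ : 0 ≤ μ) (hs : μ ≤ s) (ht : μ ≤ t) (ht0 : 0 < t)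
    (htμ : t ≤ 4 * μ + 1) : clickDiv s t ≤ 8 * ((t - s) ^ 2 / t) := by
  have hq := div_one_add_le_one_sub_exp_neg ht0.le
  have hq0 : 0 < t / (1 + t) := by positivity
  set q := 1 - exp (-t) with hqd
  set p := 1 - exp (-s) with hpd
  have hqpos : 0 < q := lt_of_lt_of_le hq0 hq
  have hp0 : 0 ≤ p := by
    have : exp (-s) ≤ 1 := exp_le_one_iff.2 (by linarith)
    linarith
  have hlog : p * log (p / q) ≤ p * (p / q - 1) := by
    rcases hp0.eq_or_lt with h | h
    · rw [← h]; simp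
    · gcongr
      exact log_le_sub_one_of_pos (by positivity)
  have hA := exp_neg_mul_sub_le hs ht
  have hB : (p - q) ^ 2 ≤ exp (-μ) ^ 2 * (t - s) ^ 2 := by
    have := abs_exp_neg_sub_exp_neg_le hs ht
    rw [← mul_pow, ← sq_abs (p - q), ← sq_abs (exp (-μ) * (t - s)), abs_mul, abs_of_pos (exp_pos _)]
    gcongr
    rw [show p - q = -(exp (-s) - exp (-t)) by rw [hqd, hpd]; ring, abs_neg]
    exact this
  have hC : (p - q) ^ 2 / q ≤ exp (-μ) * (1 + t) * ((t - s) ^ 2 / t) := by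
    have h1 : exp (-μ) ≤ 1 := exp_le_one_iff.2 (by linarith)
    calc (p - q) ^ 2 / q ≤ exp (-μ) ^ 2 * (t - s) ^ 2 / (t / (1 + t)) := by gcongr
      _ = exp (-μ) * exp (-μ) * ((1 + t) * ((t - s) ^ 2 / t)) := by field_simp
      _ ≤ exp (-μ) * 1 * ((1 + t) * ((t - s) ^ 2 / t)) := by gcongr
      _ = _ := by ring
  have hD : exp (-μ) * (1 + 2 * t) ≤ 8 := by
    have h1 := add_one_le_exp μ
    calc exp (-μ) * (1 + 2 * t) ≤ exp (-μ) * (8 * exp μ) := by gcongr; linarith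
      _ = 8 := by rw [mul_left_comm, ← exp_add]; simp
  have hE : p * (p / q - 1) + (q - p) = (p - q) ^ 2 / q := by field_simp; ring
  have hF : exp (-μ) * (t - s) ^ 2 = exp (-μ) * t * ((t - s) ^ 2 / t) := by field_simp
  have hG : exp (-s) - exp (-t) = q - p := by rw [hqd, hpd]; ring
  unfold clickDiv
  calc _ ≤ p * (p / q - 1) + (q - p + exp (-μ) * (t - s) ^ 2) := by
        rw [← hG]; exact add_le_add hlog hA
    _ = (p - q) ^ 2 / q + exp (-μ) * t * ((t - s) ^ 2 / t) := by rw [← hE, ← hF]; ring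
    _ ≤ exp (-μ) * (1 + t) * ((t - s) ^ 2 / t) + exp (-μ) * t * ((t - s) ^ 2 / t) := by gcongr
    _ = exp (-μ) * (1 + 2 * t) * ((t - s) ^ 2 / t) := by ring
    _ ≤ 8 * ((t - s) ^ 2 / t) := by gcongr

/-- When the signal amplitude is at most half that of the control, a click carries little
information. -/
theorem clickDiv_le_of_strong_control {E a b s : ℝ} (hE : 0 < E) (hE1 : E ≤ 1) (ha : 0 ≤ a)
    (hab : 2 * a ≤ b) (hs₁ : (b - a) ^ 2 ≤ s) (hs₂ : s ≤ (a + b) ^ 2) :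
    clickDiv s (b ^ 2 + E) ≤ 100 * a ^ 2 + 16 * E := by
  have hμ : b ^ 2 / 4 ≤ s := le_trans (by nlinarith) hs₁
  have h := clickDiv_le_sq_div (s := s) (t := b ^ 2 + E) (μ := b ^ 2 / 4) (by positivity) hμ
    (by nlinarith [sq_nonneg b]) (by positivity) (by linarith)
  have habs : |b ^ 2 + E - s| ≤ 5 / 2 * (a * b) + E := by
    rw [abs_le]; constructor <;> nlinarith
  have hsq : (b ^ 2 + E - s) ^ 2 ≤ 25 / 2 * (a * b) ^ 2 + 2 * E ^ 2 := by
    have h1 : (b ^ 2 + E - s) ^ 2 ≤ (5 / 2 * (a * b) + E) ^ 2 := by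
      rw [← sq_abs]; gcongr
    nlinarith [sq_nonneg (5 / 2 * (a * b) - E)]
  have hdiv : (b ^ 2 + E - s) ^ 2 / (b ^ 2 + E) ≤ 25 / 2 * a ^ 2 + 2 * E := by
    rw [div_le_iff₀ (by positivity)]
    have : 0 ≤ 25 / 2 * a ^ 2 * E + 2 * E * b ^ 2 := by positivity
    nlinarith
  linarith

/-- The trade-off behind the second-order term `log (log (1 / E))`: a pulse of `u` photons is
detected with probability at most about `u - u² / 4`, and a click is worth `L + log u`. -/
theorem one_sub_exp_neg_mul_log_le {u L : ℝ} (hu : 0 < u) (hL : 1 ≤ L) :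
    (1 - exp (-u)) * (L + log (18 * min 1 u)) ≤ u * (L - log L + 72) := by
  have hLL : log L ≤ L := (log_le_sub_one_of_pos (by linarith)).trans (by linarith)
  have hp : 0 ≤ 1 - exp (-u) := by
    have : exp (-u) ≤ 1 := exp_le_one_iff.2 (by linarith)
    linarith
  rcases le_total (L + log (18 * min 1 u)) 0 with h | h
  · have h1 : (1 - exp (-u)) * (L + log (18 * min 1 u)) ≤ 0 := mul_nonpos_of_nonneg_of_nonpos hp h
    have h2 : 0 ≤ u * (L - log L + 72) := mul_nonneg hu.le (by linarith)
    linarith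
  · have hle := one_sub_exp_neg_le_mul u hu.le
    have hw : 0 < min 1 u := lt_min one_pos hu
    have hw1 : min 1 u ≤ 1 := min_le_left _ _
    set w := min 1 u
    calc (1 - exp (-u)) * (L + log (18 * w)) ≤ u * (1 - w / 4) * (L + log (18 * w)) := by gcongr
      _ = u * ((1 - w / 4) * (L + log (18 * w))) := by ring
      _ ≤ _ := by
        gcongr
        -- This linear bound cancels the loss `w * L / 4`; it is tight at `w = 4 / L`.
        have h1 : log (18 * w) ≤ w * L / 4 - 1 + log 72 - log L := by
          have := log_le_sub_one_of_pos (show 0 < w * L / 4 by positivity)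
          have h2 : 18 * w = (w * L / 4) * (72 / L) := by field_simp; ring
          have h3 : log (72 / L) = log 72 - log L := log_div (by norm_num) (by positivity)
          rw [h2, log_mul (by positivity) (by positivity), h3]
          linarith
        have h2 : log 72 ≤ 71 := (log_le_sub_one_of_pos (by norm_num)).trans (by norm_num)
        have h3 : -(w * log (18 * w)) ≤ 1 := by
          have := log_le_sub_one_of_pos (show 0 < (18 * w)⁻¹ by positivity)
          rw [log_inv] at this
          have h4 := mul_le_mul_of_nonneg_left this hw.le
          have h5 : w * ((18 * w)⁻¹ - 1) = 1 / 18 - w := by field_simp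
          rw [h5] at h4
          linarith
        nlinarith

/-- When the signal is at least half as strong as the control, the signal is, up to terms of
order `a²`, no better than without control. -/
theorem clickDiv_le_of_weak_control {E a b s : ℝ} (hE : 0 < E) (hE1 : E < exp (-1)) (ha : 0 ≤ a)
    (hb : 0 ≤ b) (hab : b ≤ 2 * a) (hs₀ : 0 ≤ s) (hs₂ : s ≤ (a + b) ^ 2) :
    clickDiv s (b ^ 2 + E) ≤ a ^ 2 * (log (1 / E) - log (log (1 / E)) + 200) + E := by
  set L := log (1 / E) with hLd
  have hL : 1 ≤ L := one_le_log_one_div hE hE1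
  have hLL : log L ≤ L := (log_le_sub_one_of_pos (by linarith)).trans (by linarith)
  have hpexp : exp (-s) ≤ 1 := exp_le_one_iff.2 (by linarith)
  have hsecond : exp (-s) * (b ^ 2 + E - s) ≤ 4 * a ^ 2 + E := by
    have : exp (-s) * (b ^ 2 + E - s) ≤ exp (-s) * (b ^ 2 + E) := by gcongr; linarith
    have h2 : exp (-s) * (b ^ 2 + E) ≤ 1 * (b ^ 2 + E) := by gcongr
    nlinarith
  suffices hfirst : (1 - exp (-s)) * log ((1 - exp (-s)) / (1 - exp (-(b ^ 2 + E)))) ≤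
      a ^ 2 * (L - log L + 196) by
    unfold clickDiv; linarith
  have hrhs : ∀ C : ℝ, 0 ≤ C → C ≤ 196 → a ^ 2 * C ≤ a ^ 2 * (L - log L + 196) := by
    intro C _ h; gcongr; linarith
  have hrhs0 : 0 ≤ a ^ 2 * (L - log L + 196) := by simpa using hrhs 0 le_rfl (by norm_num)
  have ht0 : 0 < b ^ 2 + E := by positivity
  have hq := div_one_add_le_one_sub_exp_neg ht0.le
  set t := b ^ 2 + E with htd
  set q := 1 - exp (-t) with hqd
  set p := 1 - exp (-s) with hpd
  have hq0 : 0 < q := lt_of_lt_of_le (by positivity) hq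
  have hp0 : 0 ≤ p := by linarith
  have hp1 : p ≤ 1 := by have := exp_pos (-s); linarith
  have hps : p ≤ s := by have := one_sub_le_exp_neg s; linarith
  have hp9 : p ≤ 9 * a ^ 2 := by nlinarith
  rcases hp0.eq_or_lt with h0 | hp0'
  · rw [← h0]; simpa using hrhs0
  have ha0 : 0 < a := by
    by_contra h
    have : a = 0 := le_antisymm (not_lt.1 h) ha
    rw [this] at hp9; norm_num at hp9; linarith
  have hu0 : 0 < a ^ 2 := by positivity
  rcases le_total 1 t with ht1 | ht1
  · have hq2 : 1 / 2 ≤ q := le_trans (by rw [div_le_div_iff₀ (by norm_num) (by linarith)]; linarith) hq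
    have h2 : log (p / q) ≤ 1 := by
      refine (log_le_sub_one_of_pos (by positivity)).trans ?_
      have : p / q ≤ 2 := by rw [div_le_iff₀ hq0]; linarith
      linarith
    calc p * log (p / q) ≤ p * 1 := by gcongr
      _ ≤ a ^ 2 * 9 := by linarith
      _ ≤ _ := hrhs 9 (by norm_num) (by norm_num)
  · have hq2 : t / 2 ≤ q := le_trans (by gcongr; linarith) hq
    have hw : 0 < min 1 (a ^ 2) := lt_min one_pos hu0
    have hpw : p ≤ 9 * min 1 (a ^ 2) := by
      rcases min_choice 1 (a ^ 2) with h | h <;> rw [h] <;> linarith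
    have hr : p / q ≤ 18 * min 1 (a ^ 2) / t := by
      calc p / q ≤ 9 * min 1 (a ^ 2) / (t / 2) := by gcongr
        _ = _ := by field_simp; ring
    have hlog : log (p / q) ≤ log (18 * min 1 (a ^ 2) / t) := log_le_log (by positivity) hr
    set Λ := log (18 * min 1 (a ^ 2) / t) with hΛ
    rcases le_total Λ 0 with hΛ0 | hΛ0
    · have : p * log (p / q) ≤ 0 := mul_nonpos_of_nonneg_of_nonpos hp0 (hlog.trans hΛ0)
      linarith
    have hΛ1 : Λ ≤ L + log (18 * min 1 (a ^ 2)) := by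
      rw [hΛ, hLd, log_div (by positivity) ht0.ne', one_div, log_inv]
      have : log E ≤ log t := log_le_log hE (by nlinarith [sq_nonneg b])
      linarith
    have hcross : 4 * (a * b) * Λ ≤ 40 * a ^ 2 := by
      rcases hb.eq_or_lt with h | hb0
      · rw [← h]; simp; positivity
      · have h1 : Λ ≤ 2 * (5 * a / b) := by
          calc Λ ≤ log ((5 * a / b) ^ 2) := by
                refine log_le_log (by positivity) ?_
                rw [div_pow, mul_pow]
                refine div_le_div₀ (by positivity) ?_ (by positivity) ?_
                · have := min_le_right 1 (a ^ 2)
                  linarith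
                · linarith
            _ = 2 * log (5 * a / b) := by rw [log_pow]; norm_num
            _ ≤ _ := by
              have := log_le_sub_one_of_pos (show 0 < 5 * a / b by positivity)
              linarith
        calc 4 * (a * b) * Λ ≤ 4 * (a * b) * (2 * (5 * a / b)) := by gcongr
          _ = 40 * a ^ 2 := by field_simp; ring
    have hpsplit : p ≤ (1 - exp (-a ^ 2)) + 4 * (a * b) := by
      have h1 : exp (-(a + b) ^ 2) ≤ exp (-s) := exp_le_exp.2 (by linarith)
      have h2 : |exp (-a ^ 2) - exp (-(a + b) ^ 2)| ≤ exp (-0) * |(a + b) ^ 2 - a ^ 2| :=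
        abs_exp_neg_sub_exp_neg_le (by positivity) (by positivity)
      have h3 : |(a + b) ^ 2 - a ^ 2| = (a + b) ^ 2 - a ^ 2 := abs_of_nonneg (by nlinarith)
      rw [h3, neg_zero, exp_zero, one_mul] at h2
      have h4 := (abs_le.1 h2).2
      nlinarith
    have he : 0 ≤ 1 - exp (-a ^ 2) := by
      have : exp (-a ^ 2) ≤ 1 := exp_le_one_iff.2 (by linarith)
      linarith
    calc p * log (p / q) ≤ p * Λ := by gcongr
      _ ≤ ((1 - exp (-a ^ 2)) + 4 * (a * b)) * Λ := by gcongr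
      _ = (1 - exp (-a ^ 2)) * Λ + 4 * (a * b) * Λ := by ring
      _ ≤ (1 - exp (-a ^ 2)) * (L + log (18 * min 1 (a ^ 2))) + 40 * a ^ 2 := by gcongr
      _ ≤ a ^ 2 * (L - log L + 72) + 40 * a ^ 2 :=
        add_le_add_left (one_sub_exp_neg_mul_log_le hu0 hL) _
      _ ≤ a ^ 2 * (L - log L + 196) := by linarith

/-- The control of the reference output law against which the converse measures information: the
receiver adds `E` photons of noise to the control intensity. -/
noncomputable def referenceControl (E : ℝ) (l : ℂ) : ℂ := (√(‖l‖ ^ 2 + E) : ℝ)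

theorem norm_referenceControl_sq {E : ℝ} (hE : 0 < E) (l : ℂ) :
    ‖0 + referenceControl E l‖ ^ 2 = ‖l‖ ^ 2 + E := by
  rw [zero_add, referenceControl, Complex.norm_real, norm_of_nonneg (sqrt_nonneg _),
    sq_sqrt (by positivity)]

/-- The single-symbol converse: relative to the reference law, the output law of a symbol `x` has a
relative entropy that is bounded by an affine function of `‖x‖ ^ 2`, whatever the control. -/
theorem sum_clickProb_mul_log_le {E : ℝ} (hE : 0 < E) (hE1 : E < exp (-1)) (x l : ℂ) :
    ∑ b, clickProb x l b * log (clickProb x l b / clickProb 0 (referenceControl E l) b) ≤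
      200 * E + ‖x‖ ^ 2 * (log (1 / E) - log (log (1 / E)) + 200) := by
  have hdiv : ∑ b, clickProb x l b * log (clickProb x l b / clickProb 0 (referenceControl E l) b) =
      clickDiv (‖x + l‖ ^ 2) (‖l‖ ^ 2 + E) := by
    simp only [Fintype.sum_bool, clickProb, norm_referenceControl_sq hE, clickDiv]
    rw [← exp_sub, log_exp]
    ring_nf
  rw [hdiv]
  have h1 : ‖x + l‖ ≤ ‖x‖ + ‖l‖ := norm_add_le x l
  have h2 : ‖l‖ - ‖x‖ ≤ ‖x + l‖ := by
    have := norm_sub_norm_le l (-x)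
    rwa [norm_neg, sub_neg_eq_add, add_comm l x] at this
  have hx := norm_nonneg x
  have hl := norm_nonneg l
  have hE2 : E ≤ 1 := hE1.le.trans (exp_le_one_iff.2 (by norm_num))
  have hL : 1 ≤ log (1 / E) := one_le_log_one_div hE hE1
  have hLL : log (log (1 / E)) ≤ log (1 / E) - 1 := log_le_sub_one_of_pos (by linarith)
  rcases le_total (2 * ‖x‖) ‖l‖ with h | h
  · have := clickDiv_le_of_strong_control (s := ‖x + l‖ ^ 2) hE hE2 hx h
      (by gcongr; linarith) (by gcongr)
    nlinarith [sq_nonneg ‖x‖]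
  · have := clickDiv_le_of_weak_control (s := ‖x + l‖ ^ 2) hE hE1 hx hl h (by positivity)
      (by gcongr)
    linarith

/-! ### The converse -/

theorem clickProb_nonneg (x l : ℂ) (b : Bool) : 0 ≤ clickProb x l b := by
  cases b
  · exact (exp_pos _).le
  · have : exp (-‖x + l‖ ^ 2) ≤ 1 := exp_le_one_iff.2 (by simp)
    simp only [clickProb]; linarith

theorem sum_clickProb (x l : ℂ) : ∑ b, clickProb x l b = 1 := by
  simp [clickProb]

theorem clickProb_referenceControl_pos {E : ℝ} (hE : 0 < E) (l : ℂ) (b : Bool) :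
    0 < clickProb 0 (referenceControl E l) b := by
  cases b
  · exact exp_pos _
  · have : exp (-‖0 + referenceControl E l‖ ^ 2) < 1 := by
      rw [norm_referenceControl_sq hE, exp_lt_one_iff]
      have := sq_nonneg ‖l‖
      linarith
    simp only [clickProb]; linarith

theorem outcomeProb_nonneg {N : ℕ} (x : Fin N → ℂ) (l : Control N) (y : Fin N → Bool) :
    0 ≤ outcomeProb x l y :=
  Finset.prod_nonneg fun _ _ => clickProb_nonneg _ _ _

/-- The adaptive control during all symbols but the last. -/
def Control.init {N : ℕ} (l : Control (N + 1)) : Control N := fun i h => l i.castSucc h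

theorem outcomeProb_snoc {N : ℕ} (x : Fin (N + 1) → ℂ) (l : Control (N + 1)) (y : Fin N → Bool)
    (b : Bool) :
    outcomeProb x l (Fin.snoc y b : Fin (N + 1) → Bool) =
      outcomeProb (fun i => x i.castSucc) l.init y * clickProb (x (Fin.last N)) (l (Fin.last N) y) b := by
  unfold outcomeProb
  rw [Fin.prod_univ_castSucc]
  have hpast : ∀ i : Fin N, past (Fin.snoc y b : Fin (N + 1) → Bool) i.castSucc = past y i := by
    intro i; funext j
    exact Fin.snoc_castSucc (α := fun _ => Bool) b y (Fin.castLE i.isLt.le j)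
  have hlast : past (Fin.snoc y b : Fin (N + 1) → Bool) (Fin.last N) = y := by
    funext j
    exact Fin.snoc_castSucc (α := fun _ => Bool) b y j
  simp only [hpast, hlast, Fin.snoc_castSucc, Fin.snoc_last]
  rfl

theorem sum_snoc {N : ℕ} (f : (Fin (N + 1) → Bool) → ℝ) :
    ∑ y, f y = ∑ y : Fin N → Bool, ∑ b, f (Fin.snoc y b : Fin (N + 1) → Bool) := by
  rw [← (Fin.snocEquiv fun _ => Bool).sum_comp, Fintype.sum_prod_type, Finset.sum_comm]
  rfl

theorem sum_outcomeProb : ∀ {N : ℕ} (x : Fin N → ℂ) (l : Control N), ∑ y, outcomeProb x l y = 1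
  | 0, x, l => by simp [outcomeProb]
  | N + 1, x, l => by
    rw [sum_snoc]
    simp only [outcomeProb_snoc, ← Finset.mul_sum, sum_clickProb, mul_one]
    exact sum_outcomeProb _ _

/-- The reference control, as an adaptive control. -/
noncomputable def Control.reference {N : ℕ} (E : ℝ) (l : Control N) : Control N :=
  fun i h => referenceControl E (l i h)

theorem outcomeProb_reference_pos {N : ℕ} {E : ℝ} (hE : 0 < E) (l : Control N)
    (y : Fin N → Bool) : 0 < outcomeProb (fun _ => 0) (l.reference E) y :=
  Finset.prod_pos fun _ _ => clickProb_referenceControl_pos hE _ _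

/-- The chain rule: the relative entropy of the output law of a codeword with respect to the
reference law is at most the sum of single-symbol bounds that hold for every control. -/
theorem sum_outcomeProb_mul_log_le {E : ℝ} (hE : 0 < E) {B : ℂ → ℝ}
    (hB : ∀ x l : ℂ, ∑ b, clickProb x l b *
      log (clickProb x l b / clickProb 0 (referenceControl E l) b) ≤ B x) :
    ∀ {N : ℕ} (x : Fin N → ℂ) (l : Control N),
      ∑ y, outcomeProb x l y *
        log (outcomeProb x l y / outcomeProb (fun _ => 0) (l.reference E) y) ≤ ∑ i, B (x i)
  | 0, x, l => by simp [outcomeProb]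
  | N + 1, x, l => by
    rw [sum_snoc, Fin.sum_univ_castSucc]
    set P := outcomeProb (fun i => x i.castSucc) l.init with hP
    set Q := outcomeProb (fun _ => 0) (l.init.reference E) with hQ
    set w := fun y b => clickProb (x (Fin.last N)) (l (Fin.last N) y) b
    set v := fun y b => clickProb 0 (referenceControl E (l (Fin.last N) y)) b
    have hsplit : ∀ y b, outcomeProb x l (Fin.snoc y b : Fin (N + 1) → Bool) *
        log (outcomeProb x l (Fin.snoc y b : Fin (N + 1) → Bool) /
          outcomeProb (fun _ => 0) (l.reference E) (Fin.snoc y b : Fin (N + 1) → Bool)) =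
        P y * log (P y / Q y) * w y b + P y * (w y b * log (w y b / v y b)) := by
      intro y b
      rw [outcomeProb_snoc, outcomeProb_snoc]
      change P y * w y b * log (P y * w y b / (Q y * v y b)) = _
      have hQ0 : Q y ≠ 0 := (outcomeProb_reference_pos hE l.init y).ne'
      have hv0 : v y b ≠ 0 := (clickProb_referenceControl_pos hE _ b).ne'
      -- Outcomes of probability zero contribute `0 * log 0 = 0` on both sides.
      by_cases hP0 : P y = 0
      · simp [hP0]
      by_cases hw0 : w y b = 0
      · simp [hw0]
      rw [mul_div_mul_comm, log_mul (div_ne_zero hP0 hQ0) (div_ne_zero hw0 hv0)]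
      ring
    simp only [hsplit, Finset.sum_add_distrib, ← Finset.mul_sum]
    refine add_le_add ?_ ?_
    · have hw : ∀ y, ∑ b, w y b = 1 := fun y => sum_clickProb _ _
      simp only [hw, mul_one]
      exact sum_outcomeProb_mul_log_le hE hB _ _
    · calc ∑ y, P y * ∑ b, w y b * log (w y b / v y b) ≤ ∑ y, P y * B (x (Fin.last N)) :=
            Finset.sum_le_sum fun y _ =>
              mul_le_mul_of_nonneg_left (hB _ _) (outcomeProb_nonneg _ _ _)
        _ = B (x (Fin.last N)) := by rw [← Finset.sum_mul, sum_outcomeProb, one_mul]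

/-- The lower bound `p log (p / q) ≥ c p + p - q eᶜ`, a form of `log z ≤ z - 1`. -/
theorem mul_log_div_ge {p q : ℝ} (hp : 0 ≤ p) (hq : 0 < q) (c : ℝ) :
    c * p + p - q * exp c ≤ p * log (p / q) := by
  rcases hp.eq_or_lt with h | h
  · rw [← h]; simp; positivity
  · have h1 := log_le_sub_one_of_pos (show 0 < q * exp c / p by positivity)
    rw [log_div (by positivity) h.ne', log_mul hq.ne' (exp_pos c).ne', log_exp] at h1
    have h2 := mul_le_mul_of_nonneg_left h1 h.le
    have h3 : p * (q * exp c / p - 1) = q * exp c - p := by field_simp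
    rw [h3] at h2
    rw [log_div h.ne' hq.ne']
    linarith

/-- A form of Fano's inequality: decoding `M` messages correctly costs relative entropy about
`log M` on average, with respect to any output law that does not depend on the message. -/
theorem one_sub_errorProb_mul_log_le {𝒳 : Finset ℂ} {N M : ℕ} (hM : 0 < M) (c : Code 𝒳 N M)
    {Q : (Fin N → Bool) → ℝ} (hQ : ∀ y, 0 < Q y) (hQ1 : ∑ y, Q y = 1) :
    (1 - c.errorProb) * log M - 1 ≤
      (∑ m, ∑ y, outcomeProb (c.encode m) c.control y *
        log (outcomeProb (c.encode m) c.control y / Q y)) / M := by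
  have hM0 : (0 : ℝ) < M := by exact_mod_cast hM
  set P := fun m y => outcomeProb (c.encode m) c.control y with hPd
  have hP0 : ∀ m y, 0 ≤ P m y := fun m y => outcomeProb_nonneg _ _ _
  have hP1 : ∀ m, ∑ y, P m y = 1 := fun m => sum_outcomeProb _ _
  have herr : ∀ m, ∑ y, (if c.decode y = m then P m y else 0) =
      1 - ∑ y ∈ Finset.univ.filter (fun y => c.decode y ≠ m), P m y := by
    intro m
    rw [← hP1 m, Finset.sum_filter, eq_sub_iff_add_eq, ← Finset.sum_add_distrib]
    exact Finset.sum_congr rfl fun y _ => by by_cases h : c.decode y = m <;> simp [h]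
  -- For a correct decision the exponent `c` is `log M`; otherwise it is `0`.
  have hterm : ∀ m y, log M * (if c.decode y = m then P m y else 0) + P m y -
      (Q y + if c.decode y = m then M * Q y else 0) ≤ P m y * log (P m y / Q y) := by
    intro m y
    by_cases h : c.decode y = m
    · have := mul_log_div_ge (hP0 m y) (hQ y) (log M)
      rw [exp_log hM0] at this
      simp only [h, if_true]
      linarith [(hQ y).le]
    · have := mul_log_div_ge (hP0 m y) (hQ y) 0
      simp only [h, if_false]
      simp only [exp_zero] at this
      linarith
  have hsum := Finset.sum_le_sum fun m (_ : m ∈ Finset.univ) =>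
    Finset.sum_le_sum fun y (_ : y ∈ Finset.univ) => hterm m y
  have hguess : ∑ m, ∑ y, (if c.decode y = m then (M : ℝ) * Q y else 0) = M := by
    rw [Finset.sum_comm]
    simp [← Finset.mul_sum, hQ1]
  simp only [Finset.sum_sub_distrib, Finset.sum_add_distrib, ← Finset.mul_sum, hP1, hguess, herr,
    hQ1, Finset.sum_const, Finset.card_univ, Fintype.card_fin, nsmul_eq_mul, mul_one] at hsum
  rw [le_div_iff₀ hM0]
  have hE : c.errorProb * M =
      ∑ m, ∑ y ∈ Finset.univ.filter (fun y => c.decode y ≠ m), P m y := by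
    unfold Code.errorProb; field_simp; rfl
  calc ((1 - c.errorProb) * log M - 1) * M
      = log M * (M - c.errorProb * M) + M - (M + M) := by ring
    _ ≤ _ := by rw [hE]; exact hsum

theorem le_of_mem_coherentRates {E : ℝ} (hE : 0 < E) (hE1 : E < exp (-1)) {R : ℝ}
    (hR : R ∈ coherentRates E) :
    R ≤ E * (log (1 / E) - log (log (1 / E)) + 400) := by
  obtain ⟨𝒳, h⟩ := hR
  set G := log (1 / E) - log (log (1 / E)) + 200 with hG
  have hL : 1 ≤ log (1 / E) := one_le_log_one_div hE hE1
  have hG0 : 0 ≤ G := by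
    have := log_le_sub_one_of_pos (show 0 < log (1 / E) by linarith)
    linarith
  have hbound : ∀ ε : ℝ, 0 < ε → ε < 1 → (1 - ε) * R ≤ E * (G + 200) := by
    intro ε hε hε1
    refine le_of_forall_pos_le_add fun δ hδ => ?_
    -- The constant `1` lost in Fano's inequality is at most `δ N` for such `N`.
    obtain ⟨N, ⟨M, c, hM, hph, herr⟩, hN⟩ :=
      ((h ε hε).and (Filter.eventually_ge_atTop (⌈1 / δ⌉₊ + 1))).exists
    have hM0 : (0 : ℝ) < M := lt_of_lt_of_le (exp_pos _) hM
    have hM0' : 0 < M := by exact_mod_cast hM0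
    have hlogM : N * R ≤ log M := by
      have := log_le_log (exp_pos _) hM
      rwa [log_exp] at this
    have hlog0 : 0 ≤ log M := log_natCast_nonneg M
    have hfano := one_sub_errorProb_mul_log_le hM0' c (outcomeProb_reference_pos hE c.control)
      (sum_outcomeProb _ _)
    have hdiv : (∑ m, ∑ y, outcomeProb (c.encode m) c.control y *
        log (outcomeProb (c.encode m) c.control y /
          outcomeProb (fun _ => 0) (c.control.reference E) y)) / M ≤ N * (E * (G + 200)) := by
      rw [div_le_iff₀ hM0]
      calc _ ≤ ∑ m, ∑ i, (200 * E + ‖c.encode m i‖ ^ 2 * G) :=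
            Finset.sum_le_sum fun m _ =>
              sum_outcomeProb_mul_log_le hE (B := fun x => 200 * E + ‖x‖ ^ 2 * G)
                (sum_clickProb_mul_log_le hE hE1) _ _
        _ = ∑ i, (M * (200 * E) + c.meanPhotons i * M * G) := by
            rw [Finset.sum_comm]
            refine Finset.sum_congr rfl fun i _ => ?_
            rw [Finset.sum_add_distrib, ← Finset.sum_mul _ _ G, Code.meanPhotons]
            simp only [Finset.sum_const, Finset.card_univ, Fintype.card_fin, nsmul_eq_mul]
            field_simp
        _ ≤ ∑ i : Fin N, (M * (200 * E) + E * M * G) := by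
            gcongr with i; exact hph i
        _ = N * (E * (G + 200)) * M := by simp; ring
    have hN1 : 1 ≤ δ * N := by
      have h1 : 1 / δ ≤ N := (Nat.le_ceil _).trans (by exact_mod_cast (by omega))
      rwa [div_le_iff₀ hδ, mul_comm] at h1
    have hN0 : (0 : ℝ) < N := by
      have : 0 < N := by omega
      exact_mod_cast this
    have h1 : (1 - ε) * (N * R) ≤ (1 - c.errorProb) * log M :=
      (mul_le_mul_of_nonneg_left hlogM (by linarith)).trans
        (mul_le_mul_of_nonneg_right (by linarith) hlog0)
    have h2 : N * ((1 - ε) * R) ≤ N * (E * (G + 200) + δ) := by linarith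
    exact le_of_mul_le_mul_left h2 hN0
  have hG2 : log (1 / E) - log (log (1 / E)) + 400 = G + 200 := by rw [hG]; ring
  rw [hG2]
  have hlim : Filter.Tendsto (fun ε : ℝ => (1 - ε) * R) (nhdsWithin 0 (Set.Ioi 0)) (nhds R) := by
    have : Filter.Tendsto (fun ε : ℝ => (1 - ε) * R) (nhds 0) (nhds ((1 - 0) * R)) :=
      (by fun_prop : Continuous fun ε : ℝ => (1 - ε) * R).tendsto 0
    simpa using this.mono_left nhdsWithin_le_nhds
  refine le_of_tendsto hlim ?_
  filter_upwards [Ioo_mem_nhdsGT (show (0 : ℝ) < 1 by norm_num)] with ε hε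
  exact hbound ε hε.1 hε.2

/-! ### Random on-off codes -/

/-- The indicator of a Boolean, as a real number. -/
def boolIndicator (b : Bool) : ℝ := if b then 1 else 0

/-- The pulse pattern of one symbol, over messages `m = (s, w)`, for a function `γ` of `w`: the
message `(s, w)` sends a pulse when `s + γ w = 0`.  The shift `s` makes exactly one message in `B`
send a pulse, for every `γ`. -/
def pulse {B ν : ℕ} [NeZero B] (γ : Fin ν → Fin B) (m : Fin B × Fin ν) : Bool :=
  decide (m.1 + γ m.2 = 0)

section Pulse

variable {B ν : ℕ} [NeZero B]

theorem sum_boolIndicator_decide_add_eq_zero (c : Fin B) :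
    ∑ s : Fin B, boolIndicator (decide (s + c = 0)) = 1 := by
  simp [boolIndicator, add_eq_zero_iff_eq_neg]

theorem sum_messages_pulse (γ : Fin ν → Fin B) : ∑ m, boolIndicator (pulse γ m) = ν := by
  rw [Fintype.sum_prod_type, Finset.sum_comm]
  simp [pulse, sum_boolIndicator_decide_add_eq_zero]

/-- Averaging over the value of `γ` at one point `w`, when a factor does not see that value. -/
theorem mul_sum_mul_pulse (f : (Fin ν → Fin B) → ℝ) (m : Fin B × Fin ν)
    (hf : ∀ γ c, f (γ + Pi.single m.2 c) = f γ) :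
    B * ∑ γ, f γ * boolIndicator (pulse γ m) = ∑ γ, f γ := by
  have hshift : ∀ c : Fin B, ∑ γ, f γ * boolIndicator (pulse γ m) =
      ∑ γ, f γ * boolIndicator (decide (c + (m.1 + γ m.2) = 0)) := by
    intro c
    rw [← Equiv.sum_comp (Equiv.addRight (Pi.single m.2 c : Fin ν → Fin B))]
    refine Finset.sum_congr rfl fun γ _ => ?_
    have h : m.1 + (γ m.2 + c) = c + (m.1 + γ m.2) := by abel
    simp [hf, pulse, h]
  calc B * ∑ γ, f γ * boolIndicator (pulse γ m)
      = ∑ _c : Fin B, ∑ γ, f γ * boolIndicator (pulse γ m) := by simp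
    _ = ∑ c : Fin B, ∑ γ, f γ * boolIndicator (decide (c + (m.1 + γ m.2) = 0)) :=
        Finset.sum_congr rfl fun c _ => hshift c
    _ = ∑ γ, f γ := by
        rw [Finset.sum_comm]
        simp [← Finset.mul_sum, sum_boolIndicator_decide_add_eq_zero]

theorem mul_sum_pulse (m : Fin B × Fin ν) :
    B * ∑ γ : Fin ν → Fin B, boolIndicator (pulse γ m) = Fintype.card (Fin ν → Fin B) := by
  simpa using mul_sum_mul_pulse (fun _ => 1) m (fun _ _ => rfl)

/-- Two messages share a pulse for at most a fraction `1 / B` of the patterns in which the first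
one has a pulse. -/
theorem mul_sum_pulse_mul_pulse_le {m m' : Fin B × Fin ν} (h : m ≠ m') :
    B * ∑ γ : Fin ν → Fin B, boolIndicator (pulse γ m) * boolIndicator (pulse γ m') ≤
      ∑ γ : Fin ν → Fin B, boolIndicator (pulse γ m) := by
  by_cases hw : m.2 = m'.2
  · have h0 : ∀ γ : Fin ν → Fin B, boolIndicator (pulse γ m) * boolIndicator (pulse γ m') = 0 := by
      intro γ
      by_contra hne
      simp only [boolIndicator, pulse, mul_eq_zero, not_or] at hne
      have h1 : m.1 + γ m.2 = 0 := by by_contra h; simp [h] at hne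
      have h2 : m'.1 + γ m'.2 = 0 := by by_contra h; simp [h] at hne
      rw [← hw] at h2
      exact h (Prod.ext (add_right_cancel (h1.trans h2.symm)) hw)
    simp only [h0, Finset.sum_const_zero, mul_zero]
    exact Finset.sum_nonneg fun γ _ => by unfold boolIndicator; split_ifs <;> norm_num
  · refine (mul_sum_mul_pulse (fun γ => boolIndicator (pulse γ m)) m' fun γ c => ?_).le
    simp [pulse, Pi.single_eq_of_ne hw]

end Pulse

section OnOff

variable {N M : ℕ}

/-- An outcome sequence is consistent with a message of an on-off code when there are clicks only
where the message sends a pulse. -/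
def Consistent (g : Fin N → Fin M → Bool) (m : Fin M) (y : Fin N → Bool) : Prop :=
  ∀ i, y i = true → g i m = true

open Classical in
/-- The on-off code in which message `m` sends a pulse of amplitude `a` at the symbols `i` with
`g i m = true`.  The direct-detection receiver picks some consistent message; the message `m₀` is
only the default for outcomes without any. -/
noncomputable def onOffCode (a : ℝ) (g : Fin N → Fin M → Bool) (m₀ : Fin M) :
    Code {0, (a : ℂ)} N M where
  encode m i := if g i m then a else 0
  encode_mem m i := by split_ifs <;> simp
  control _ _ := 0
  decode y := if h : ∃ m, Consistent g m y then h.choose else m₀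

/-- The click law of an on-off symbol: the Z-channel in which a pulse makes a click with
probability `p`, and there are no clicks without a pulse. -/
def zChannel (p : ℝ) : Bool → Bool → ℝ
  | true, true => p
  | true, false => 1 - p
  | false, true => 0
  | false, false => 1

theorem outcomeProb_onOffCode (a : ℝ) (g : Fin N → Fin M → Bool) (m₀ m : Fin M)
    (y : Fin N → Bool) :
    outcomeProb ((onOffCode a g m₀).encode m) (onOffCode a g m₀).control y =
      ∏ i, zChannel (1 - exp (-a ^ 2)) (g i m) (y i) := by
  refine Finset.prod_congr rfl fun i _ => ?_
  simp only [onOffCode]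
  cases g i m <;> cases y i <;> simp [clickProb, zChannel]

theorem consistent_of_prod_ne_zero {p : ℝ} {g : Fin N → Fin M → Bool} {m : Fin M}
    {y : Fin N → Bool} (h : ∏ i, zChannel p (g i m) (y i) ≠ 0) : Consistent g m y := by
  intro i hy
  have := (Finset.prod_ne_zero_iff.1 h) i (Finset.mem_univ i)
  cases hg : g i m
  · simp [hg, hy, zChannel] at this
  · rfl

theorem zChannel_nonneg {p : ℝ} (hp0 : 0 ≤ p) (hp1 : p ≤ 1) (b c : Bool) : 0 ≤ zChannel p b c := by
  cases b <;> cases c <;> simp [zChannel, hp0, hp1]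

theorem prod_ite_eq_pow (θ : ℝ) (y : Fin N → Bool) :
    ∏ i, (if y i then θ else 1) = θ ^ (Finset.univ.filter fun i => y i = true).card := by
  rw [Finset.prod_ite]; simp

/-- A decoding error needs either at most `k` clicks, or at least `k` clicks that are all consistent
with another message; the two events are bounded by `θ ^ (clicks - k)` and `B ^ (clicks - k)`. -/
theorem error_term_le {p θ B : ℝ} {k : ℕ} (hp0 : 0 ≤ p) (hp1 : p ≤ 1) (hθ : 0 < θ) (hθ1 : θ ≤ 1)
    (hB : 1 ≤ B) (g : Fin N → Fin M → Bool) (a : ℝ) (m₀ m : Fin M) (y : Fin N → Bool)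
    (hdec : (onOffCode a g m₀).decode y ≠ m) :
    ∏ i, zChannel p (g i m) (y i) ≤
      (∏ i, zChannel p (g i m) (y i) * if y i then θ else 1) / θ ^ k +
      ∑ m' ∈ Finset.univ.erase m, (∏ i, zChannel p (g i m) (y i) *
        if y i then B * boolIndicator (g i m') else 1) / B ^ k := by
  set P := ∏ i, zChannel p (g i m) (y i) with hP
  have hP0 : 0 ≤ P := Finset.prod_nonneg fun _ _ => zChannel_nonneg hp0 hp1 _ _
  have hnn : ∀ m', 0 ≤ (∏ i, zChannel p (g i m) (y i) *
        if y i then B * boolIndicator (g i m') else 1) / B ^ k := by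
    intro m'
    refine div_nonneg (Finset.prod_nonneg fun i _ => mul_nonneg (zChannel_nonneg hp0 hp1 _ _) ?_)
      (by positivity)
    unfold boolIndicator
    split_ifs <;> simp
    linarith
  have h1 : 0 ≤ (∏ i, zChannel p (g i m) (y i) * if y i then θ else 1) / θ ^ k := by
    refine div_nonneg (Finset.prod_nonneg fun i _ => mul_nonneg (zChannel_nonneg hp0 hp1 _ _) ?_)
      (by positivity)
    split_ifs <;> linarith
  by_cases hPz : P = 0
  · rw [hPz]
    exact add_nonneg h1 (Finset.sum_nonneg fun m' _ => hnn m')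
  set n := (Finset.univ.filter fun i => y i = true).card with hn
  rcases le_total n k with hnk | hnk
  · refine le_add_of_le_of_nonneg ?_ (Finset.sum_nonneg fun m' _ => hnn m')
    rw [Finset.prod_mul_distrib, prod_ite_eq_pow, le_div_iff₀ (by positivity)]
    exact mul_le_mul_of_nonneg_left (pow_le_pow_of_le_one hθ.le hθ1 hnk) hP0
  · refine le_add_of_nonneg_of_le h1 ?_
    have hex : ∃ m', Consistent g m' y := ⟨m, consistent_of_prod_ne_zero hPz⟩
    have hd : (onOffCode a g m₀).decode y = hex.choose := dif_pos hex
    have hc := hex.choose_spec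
    rw [← hd] at hc
    set m' := (onOffCode a g m₀).decode y
    refine le_trans ?_ (Finset.single_le_sum (fun m' _ => hnn m')
      (Finset.mem_erase.2 ⟨hdec, Finset.mem_univ m'⟩))
    have hprod : ∀ i, (if y i then B * boolIndicator (g i m') else 1) = if y i then B else 1 := by
      intro i
      by_cases h : y i = true
      · simp [h, hc i h, boolIndicator]
      · simp [h]
    simp only [hprod]
    rw [Finset.prod_mul_distrib, prod_ite_eq_pow, le_div_iff₀ (by positivity)]
    exact mul_le_mul_of_nonneg_left (pow_le_pow_right₀ hB hnk) hP0

theorem errorProb_onOffCode_le {θ B : ℝ} (k : ℕ) (hθ : 0 < θ) (hθ1 : θ ≤ 1) (hB : 1 ≤ B)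
    (g : Fin N → Fin M → Bool) (a : ℝ) (m₀ : Fin M) :
    (onOffCode a g m₀).errorProb ≤ (∑ m,
      ((∏ i, (1 - (1 - exp (-a ^ 2)) * (1 - θ) * boolIndicator (g i m))) / θ ^ k +
      ∑ m' ∈ Finset.univ.erase m, (∏ i, (1 - (1 - exp (-a ^ 2)) * boolIndicator (g i m) +
        (1 - exp (-a ^ 2)) * B * (boolIndicator (g i m) * boolIndicator (g i m')))) / B ^ k)) / M := by
  have hp0 : 0 ≤ 1 - exp (-a ^ 2) := by
    have : exp (-a ^ 2) ≤ 1 := exp_le_one_iff.2 (by nlinarith)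
    linarith
  have hp1 : 1 - exp (-a ^ 2) ≤ 1 := by have := exp_pos (-a ^ 2); linarith
  unfold Code.errorProb
  simp only [outcomeProb_onOffCode]
  set p := 1 - exp (-a ^ 2)
  refine div_le_div_of_nonneg_right (Finset.sum_le_sum fun m _ => ?_) (by positivity)
  have hprod : ∀ F : Fin N → Bool → ℝ, ∑ y : Fin N → Bool, ∏ i, F i (y i) = ∏ i, ∑ b, F i b :=
    fun F => (Fintype.prod_sum F).symm
  have h1 : ∀ i, ∑ b, zChannel p (g i m) b * (if b then θ else 1) =
      1 - p * (1 - θ) * boolIndicator (g i m) := by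
    intro i
    cases g i m <;> simp [zChannel, boolIndicator]
    ring
  have h2 : ∀ m' i, ∑ b, zChannel p (g i m) b * (if b then B * boolIndicator (g i m') else 1) =
      1 - p * boolIndicator (g i m) + p * B * (boolIndicator (g i m) * boolIndicator (g i m')) := by
    intro m' i
    cases g i m <;> cases g i m' <;> simp [zChannel, boolIndicator]
    ring
  set T : (Fin N → Bool) → ℝ := fun y =>
      (∏ i, zChannel p (g i m) (y i) * if y i then θ else 1) / θ ^ k +
      ∑ m' ∈ Finset.univ.erase m, (∏ i, zChannel p (g i m) (y i) *
        if y i then B * boolIndicator (g i m') else 1) / B ^ k with hT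
  have hT0 : ∀ y, 0 ≤ T y := by
    intro y
    refine add_nonneg (div_nonneg (Finset.prod_nonneg fun i _ =>
      mul_nonneg (zChannel_nonneg hp0 hp1 _ _) ?_) (by positivity))
      (Finset.sum_nonneg fun m' _ => div_nonneg (Finset.prod_nonneg fun i _ =>
        mul_nonneg (zChannel_nonneg hp0 hp1 _ _) ?_) (by positivity))
    · split_ifs <;> linarith
    · unfold boolIndicator
      split_ifs <;> simp
      linarith
  calc ∑ y ∈ Finset.univ.filter (fun y => (onOffCode a g m₀).decode y ≠ m),
        ∏ i, zChannel p (g i m) (y i)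
      ≤ ∑ y ∈ Finset.univ.filter (fun y => (onOffCode a g m₀).decode y ≠ m), T y :=
        Finset.sum_le_sum fun y hy =>
          error_term_le hp0 hp1 hθ hθ1 hB g a m₀ m y (Finset.mem_filter.1 hy).2
    _ ≤ ∑ y, T y := Finset.sum_le_sum_of_subset_of_nonneg (Finset.filter_subset _ _)
        fun y _ _ => hT0 y
    _ = _ := by
        simp only [hT, Finset.sum_add_distrib]
        rw [← Finset.sum_div, Finset.sum_comm (s := Finset.univ)]
        simp only [← Finset.sum_div]
        rw [hprod fun i b => zChannel p (g i m) b * if b then θ else 1]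
        simp only [h1]
        congr 2
        refine Finset.sum_congr rfl fun m' _ => ?_
        rw [hprod fun i b => zChannel p (g i m) b * if b then B * boolIndicator (g i m') else 1]
        simp only [h2]

/-- Random coding: on average over the patterns `γ`, drawn independently for the `N` symbols, the
on-off code meets the photon constraint exactly and has a small error probability. -/
theorem exists_onOffCode {B ν : ℕ} (hB : 1 ≤ B) (hν : 1 ≤ ν) (N k : ℕ) (a : ℝ) {θ : ℝ}
    (hθ : 0 < θ) (hθ1 : θ ≤ 1) :
    ∃ c : Code {0, (a : ℂ)} N (B * ν), c.IsDirect ∧ (∀ i, c.meanPhotons i ≤ a ^ 2 / B) ∧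
      c.errorProb ≤ (1 - (1 - exp (-a ^ 2)) * (1 - θ) / B) ^ N / θ ^ k + B * ν / (B : ℝ) ^ k := by
  have : NeZero B := ⟨by omega⟩
  have hBr : (1 : ℝ) ≤ B := by exact_mod_cast hB
  have hB0 : (0 : ℝ) < B := by linarith
  have hν0 : (0 : ℝ) < ν := by exact_mod_cast hν
  have hM : 0 < B * ν := Nat.mul_pos hB hν
  set e : Fin (B * ν) ≃ Fin B × Fin ν := finProdFinEquiv.symm
  set G : (Fin N → Fin ν → Fin B) → Fin N → Fin (B * ν) → Bool := fun h i m => pulse (h i) (e m)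
  obtain ⟨K, hK⟩ : ∃ K : ℝ, K = Fintype.card (Fin ν → Fin B) := ⟨_, rfl⟩
  have hK0 : 0 < K := by rw [hK]; exact_mod_cast Fintype.card_pos
  set p := 1 - exp (-a ^ 2) with hp
  have hp0 : 0 ≤ p := by
    have : exp (-a ^ 2) ≤ 1 := exp_le_one_iff.2 (by nlinarith)
    linarith
  have hp1 : p ≤ 1 := by have := exp_pos (-a ^ 2); linarith
  have hI0 : ∀ b, 0 ≤ boolIndicator b := by intro b; cases b <;> simp [boolIndicator]
  have hI1 : ∀ b, boolIndicator b ≤ 1 := by intro b; cases b <;> simp [boolIndicator]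
  have hprod : ∀ F : (Fin ν → Fin B) → ℝ, ∑ h : Fin N → Fin ν → Fin B, ∏ i, F (h i) =
      (∑ γ, F γ) ^ N := by
    intro F
    rw [← Fintype.prod_sum fun (_ : Fin N) γ => F γ]
    simp
  have h1 : ∀ m, ∑ γ : Fin ν → Fin B, (1 - p * (1 - θ) * boolIndicator (pulse γ m)) =
      K * (1 - p * (1 - θ) / B) := by
    intro m
    have h := mul_sum_pulse (ν := ν) m
    rw [Finset.sum_sub_distrib, ← Finset.mul_sum]
    simp only [Finset.sum_const, Finset.card_univ, nsmul_eq_mul, mul_one]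
    rw [← hK] at h ⊢
    rw [← h]
    field_simp
  have h2 : ∀ m m', m ≠ m' → ∑ γ : Fin ν → Fin B, (1 - p * boolIndicator (pulse γ m) +
      p * B * (boolIndicator (pulse γ m) * boolIndicator (pulse γ m'))) ≤ K := by
    intro m m' hne
    have h := mul_sum_pulse_mul_pulse_le hne
    rw [Finset.sum_add_distrib, Finset.sum_sub_distrib, ← Finset.mul_sum, ← Finset.mul_sum]
    simp only [Finset.sum_const, Finset.card_univ, nsmul_eq_mul, mul_one]
    rw [← hK, mul_assoc]
    have := mul_le_mul_of_nonneg_left h hp0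
    linarith
  have havg : ∑ h, (onOffCode a (G h) ⟨0, hM⟩).errorProb ≤
      ∑ _h : Fin N → Fin ν → Fin B,
        ((1 - p * (1 - θ) / B) ^ N / θ ^ k + B * ν / (B : ℝ) ^ k) := by
    have hcard : (Fintype.card (Fin N → Fin ν → Fin B) : ℝ) = K ^ N := by
      rw [hK, Fintype.card_fun, Fintype.card_fin]; push_cast; rfl
    have hone : ∀ m, ∑ h : Fin N → Fin ν → Fin B,
        ((∏ i, (1 - p * (1 - θ) * boolIndicator (G h i m))) / θ ^ k +
        ∑ m' ∈ Finset.univ.erase m, (∏ i, (1 - p * boolIndicator (G h i m) +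
          p * B * (boolIndicator (G h i m) * boolIndicator (G h i m')))) / (B : ℝ) ^ k) ≤
        K ^ N * ((1 - p * (1 - θ) / B) ^ N / θ ^ k + B * ν / (B : ℝ) ^ k) := by
      intro m
      rw [Finset.sum_add_distrib, ← Finset.sum_div, Finset.sum_comm, mul_add]
      refine add_le_add (le_of_eq ?_) ?_
      · rw [hprod fun γ => 1 - p * (1 - θ) * boolIndicator (pulse γ (e m)), h1, mul_pow, mul_div_assoc]
      · calc _ ≤ ∑ m' ∈ Finset.univ.erase m, K ^ N / (B : ℝ) ^ k := by
              refine Finset.sum_le_sum fun m' hm' => ?_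
              rw [← Finset.sum_div, hprod fun γ => 1 - p * boolIndicator (pulse γ (e m)) +
                p * B * (boolIndicator (pulse γ (e m)) * boolIndicator (pulse γ (e m')))]
              gcongr
              · refine Finset.sum_nonneg fun γ _ => ?_
                have h3 := mul_le_mul hp1 (hI1 (pulse γ (e m))) (hI0 _) zero_le_one
                have h4 : 0 ≤ p * B * (boolIndicator (pulse γ (e m)) *
                    boolIndicator (pulse γ (e m'))) :=
                  mul_nonneg (mul_nonneg hp0 hB0.le) (mul_nonneg (hI0 _) (hI0 _))
                linarith
              · exact h2 _ _ fun h => (Finset.mem_erase.1 hm').1 (e.injective h).symm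
          _ ≤ ∑ m' : Fin (B * ν), K ^ N / (B : ℝ) ^ k :=
              Finset.sum_le_sum_of_subset_of_nonneg (Finset.subset_univ _)
                fun _ _ _ => by positivity
          _ = _ := by simp; ring
    calc _ ≤ ∑ h : Fin N → Fin ν → Fin B, (∑ m,
          ((∏ i, (1 - p * (1 - θ) * boolIndicator (G h i m))) / θ ^ k +
          ∑ m' ∈ Finset.univ.erase m, (∏ i, (1 - p * boolIndicator (G h i m) +
            p * B * (boolIndicator (G h i m) * boolIndicator (G h i m')))) / (B : ℝ) ^ k)) /
              ((B * ν : ℕ) : ℝ) :=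
          Finset.sum_le_sum fun h _ => errorProb_onOffCode_le k hθ hθ1 hBr (G h) a ⟨0, hM⟩
      _ ≤ (∑ m : Fin (B * ν),
          K ^ N * ((1 - p * (1 - θ) / B) ^ N / θ ^ k + B * ν / (B : ℝ) ^ k)) /
            ((B * ν : ℕ) : ℝ) := by
          rw [← Finset.sum_div, Finset.sum_comm]
          gcongr with m
          exact hone m
      _ = _ := by
          have : ((B * ν : ℕ) : ℝ) ≠ 0 := by exact_mod_cast hM.ne'
          simp only [Finset.sum_const, Finset.card_univ, Fintype.card_fin, nsmul_eq_mul, hcard]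
          field_simp
  obtain ⟨h, -, hh⟩ := Finset.exists_le_of_sum_le Finset.univ_nonempty havg
  refine ⟨onOffCode a (G h) ⟨0, hM⟩, fun _ _ => rfl, fun i => le_of_eq ?_, hh⟩
  have henc : ∀ m, ‖(onOffCode a (G h) ⟨0, hM⟩).encode m i‖ ^ 2 =
      a ^ 2 * boolIndicator (pulse (h i) (e m)) := by
    intro m
    change ‖if pulse (h i) (e m) = true then (a : ℂ) else 0‖ ^ 2 = _
    cases pulse (h i) (e m) <;> simp [boolIndicator]
  unfold Code.meanPhotons
  simp only [henc]
  rw [← Finset.mul_sum, e.sum_comp fun m => boolIndicator (pulse (h i) m), sum_messages_pulse]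
  push_cast
  field_simp

end OnOff

/-! ### Achievable rates and capacities -/

theorem directRates_subset_coherentRates (E : ℝ) : directRates E ⊆ coherentRates E := by
  rintro R ⟨𝒳, h⟩
  refine ⟨𝒳, fun ε hε => (h ε hε).mono ?_⟩
  rintro N ⟨M, c, -, hc⟩
  exact ⟨M, c, hc⟩

/-- One message can be sent without photons and without error. -/
theorem zero_mem_directRates {E : ℝ} (hE : 0 < E) : (0 : ℝ) ∈ directRates E := by
  refine ⟨{0}, fun ε hε => Filter.Eventually.of_forall fun N => ⟨1,
    ⟨fun _ _ => 0, by simp, fun _ _ => 0, fun _ => 0⟩, fun _ _ => rfl, by simp, fun i => ?_, ?_⟩⟩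
  · simpa [Code.meanPhotons] using hE.le
  · have h : ∀ m : Fin 1, 0 = m := fun m => Subsingleton.elim _ _
    simpa [Code.errorProb, h] using hε.le

theorem eventually_mul_exp_le (A : ℝ) {η ε : ℝ} (hη : 0 < η) (hε : 0 < ε) :
    ∀ᶠ N : ℕ in Filter.atTop, A * exp (-(N * η)) ≤ ε := by
  have h1 : Filter.Tendsto (fun N : ℕ => (N : ℝ) * η) Filter.atTop Filter.atTop :=
    tendsto_natCast_atTop_atTop.atTop_mul_const hη
  have h2 : Filter.Tendsto (fun N : ℕ => A * exp (-((N : ℝ) * η))) Filter.atTop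
      (nhds (A * 0)) :=
    (tendsto_exp_neg_atTop_nhds_zero.comp h1).const_mul A
  rw [mul_zero] at h2
  exact (h2.eventually_lt_const hε).mono fun N h => h.le

/-- A pulse in a fraction `1 / B` of the symbols, detected with probability `1 - exp (-E B)`,
conveys up to `log B` nats each time it is detected. -/
theorem mem_directRates {E : ℝ} (hE : 0 < E) {B : ℕ} (hB : 2 ≤ B) {R : ℝ} (hR0 : 0 ≤ R)
    (hR : R < (1 - exp (-(E * B))) / B * log B) : R ∈ directRates E := by
  have hB2 : (2 : ℝ) ≤ B := by exact_mod_cast hB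
  have hB0 : (0 : ℝ) < B := by linarith
  have hlogB : 0 < log B := log_pos (by linarith)
  set a := √(E * B) with ha
  have ha2 : a ^ 2 = E * B := sq_sqrt (by positivity)
  set r := (1 - exp (-(E * B))) / B with hr
  obtain ⟨c, hRc, hcr⟩ := exists_between ((div_lt_iff₀ hlogB).2 hR)
  have hc0 : 0 < c := lt_of_le_of_lt (by positivity) hRc
  have hη₂ : 0 < c * log B - R := by
    have := (div_lt_iff₀ hlogB).1 hRc
    linarith
  -- `τ` is small enough that the Chernoff exponent `r (1 - exp (-τ)) - c τ` is positive.
  set τ := (r - c) / (2 * c) with hτ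
  have hτ0 : 0 < τ := div_pos (by linarith) (by positivity)
  have hη₁ : 0 < r * (1 - exp (-τ)) - c * τ := by
    have h1 := div_one_add_le_one_sub_exp_neg hτ0.le
    have h2 : r * (τ / (1 + τ)) ≤ r * (1 - exp (-τ)) :=
      mul_le_mul_of_nonneg_left h1 (by linarith)
    have h3 : c * τ < r * (τ / (1 + τ)) := by
      have h4 : c * (1 + τ) < r := by
        have : c * τ = (r - c) / 2 := by rw [hτ]; field_simp
        linarith
      rw [← mul_div_assoc r τ, lt_div_iff₀ (by positivity)]
      nlinarith
    linarith
  refine ⟨{0, (a : ℂ)}, fun ε hε => ?_⟩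
  filter_upwards [eventually_mul_exp_le (exp τ) hη₁ (half_pos hε),
    eventually_mul_exp_le (2 * B) hη₂ (half_pos hε)] with N hN₁ hN₂
  set ν := ⌈exp (N * R)⌉₊ with hν
  set k := ⌈c * N⌉₊ with hk
  have hν1 : 1 ≤ ν := Nat.one_le_iff_ne_zero.2 (Nat.ceil_pos.2 (exp_pos _)).ne'
  have hk1 : c * N ≤ k := Nat.le_ceil _
  have hk2 : (k : ℝ) ≤ c * N + 1 := (Nat.ceil_lt_add_one (by positivity)).le
  have hνle : exp (N * R) ≤ ν := Nat.le_ceil _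
  have hν2 : (ν : ℝ) ≤ 2 * exp (N * R) := by
    have h1 := (Nat.ceil_lt_add_one (exp_pos (N * R)).le).le
    have h2 : 1 ≤ exp (N * R) := one_le_exp (by positivity)
    linarith
  obtain ⟨code, hdir, hph, herr⟩ := exists_onOffCode (B := B) (by omega) hν1 N k a
    (exp_pos (-τ)) (exp_le_one_iff.2 (by linarith))
  refine ⟨B * ν, code, hdir, ?_, fun i => (hph i).trans ?_, herr.trans ?_⟩
  · push_cast
    nlinarith [exp_pos (N * R)]
  · rw [ha2]; field_simp; rfl
  · have h1 : (1 - (1 - exp (-a ^ 2)) * (1 - exp (-τ)) / B) ^ N / exp (-τ) ^ k ≤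
        exp τ * exp (-(N * (r * (1 - exp (-τ)) - c * τ))) := by
      rw [show (1 - exp (-a ^ 2)) * (1 - exp (-τ)) / B = r * (1 - exp (-τ)) by
        rw [hr, ha2]; ring]
      have hbase : 0 ≤ 1 - r * (1 - exp (-τ)) := by
        have h2 : r ≤ 1 := by
          rw [hr, div_le_one hB0]
          have := exp_pos (-(E * B))
          linarith
        have h3 : exp (-τ) ≤ 1 := exp_le_one_iff.2 (by linarith)
        have h4 := exp_pos (-τ)
        nlinarith
      calc (1 - r * (1 - exp (-τ))) ^ N / exp (-τ) ^ k
          ≤ exp (-(r * (1 - exp (-τ)))) ^ N / exp (-τ) ^ k := by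
            gcongr; exact one_sub_le_exp_neg _
        _ = exp (N * -(r * (1 - exp (-τ))) - k * -τ) := by
            rw [← exp_nat_mul, ← exp_nat_mul, exp_sub]
        _ ≤ exp (τ + -(N * (r * (1 - exp (-τ)) - c * τ))) := by
            refine exp_le_exp.2 ?_
            nlinarith
        _ = _ := exp_add _ _
    have h2 : B * ν / (B : ℝ) ^ k ≤ 2 * B * exp (-(N * (c * log B - R))) := by
      have hpow : (B : ℝ) ^ k = exp (k * log B) := by rw [exp_nat_mul, exp_log hB0]
      calc B * ν / (B : ℝ) ^ k ≤ B * (2 * exp (N * R)) / exp (c * N * log B) := by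
            rw [hpow]; gcongr
        _ = 2 * B * (exp (N * R) / exp (c * N * log B)) := by ring
        _ = _ := by rw [← exp_sub]; congr 2; ring
    linarith

theorem directCapacity_ge {E : ℝ} (hE : 0 < E) (hbdd : BddAbove (directRates E)) {B : ℕ}
    (hB : 1 ≤ B) : (1 - exp (-(E * B))) / B * log B ≤ directCapacity E := by
  have h0 : 0 ≤ directCapacity E := le_csSup hbdd (zero_mem_directRates hE)
  rcases hB.eq_or_lt with h | h
  · rw [← h]; simpa using h0
  · refine le_of_forall_lt fun R hR => ?_
    rcases lt_or_ge R 0 with hR0 | hR0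
    · linarith
    · obtain ⟨R', h1, h2⟩ := exists_between hR
      exact h1.trans_le (le_csSup hbdd (mem_directRates hE h (hR0.trans h1.le) h2))

theorem directCapacity_div_ge {E : ℝ} (hE : 0 < E) (hE1 : E < exp (-1))
    (hbdd : BddAbove (directRates E)) :
    log (1 / E) - log (log (1 / E)) - 2 ≤ directCapacity E / E := by
  set L := log (1 / E) with hLd
  have hL : 1 ≤ L := one_le_log_one_div hE hE1
  have hLE : L ≤ 1 / E := (log_le_sub_one_of_pos (by positivity)).trans (by linarith)
  have hEL : 1 ≤ 1 / (E * L) := by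
    rw [le_div_iff₀ (by positivity)]
    rw [le_div_iff₀ hE] at hLE
    linarith
  -- The pulse energy `E B` is about `1 / L`, which balances missed clicks against rare pulses.
  set B := ⌊1 / (E * L)⌋₊ with hBd
  have hB1 : 1 ≤ B := Nat.le_floor (by simpa using hEL)
  have hB1r : (1 : ℝ) ≤ B := by exact_mod_cast hB1
  have hBle : (B : ℝ) ≤ 1 / (E * L) := Nat.floor_le (by positivity)
  have hBge : 1 / (2 * (E * L)) ≤ B := by
    have h1 := Nat.lt_floor_add_one (1 / (E * L))
    have h2 : 1 / (2 * (E * L)) = 1 / (E * L) / 2 := by field_simp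
    rw [h2]
    linarith
  have hEB : E * B * L ≤ 1 := by
    rw [le_div_iff₀ (by positivity)] at hBle
    linarith
  have hEB1 : 0 < E * B := by positivity
  have hlogB0 : 0 ≤ log B := log_nonneg hB1r
  have hlogB : L - log L - log 2 ≤ log B := by
    have h := log_le_log (by positivity) hBge
    rw [one_div, log_inv, log_mul (by norm_num) (by positivity), log_mul hE.ne' (by positivity)] at h
    rw [one_div, log_inv] at hLd
    linarith
  have hlogBL : log B ≤ L := by
    refine log_le_log (by positivity) (hBle.trans ?_)
    gcongr
    nlinarith
  have hlog2 : log 2 ≤ 1 := (log_le_sub_one_of_pos (by norm_num)).trans (by norm_num)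
  have hp : E * B * (1 - E * B) ≤ 1 - exp (-(E * B)) := by
    refine le_trans ?_ (div_one_add_le_one_sub_exp_neg hEB1.le)
    rw [le_div_iff₀ (by positivity)]
    have : 0 ≤ (E * B) ^ 3 := by positivity
    nlinarith
  rw [le_div_iff₀ hE]
  calc (L - log L - 2) * E ≤ (log B - E * B * L) * E :=
        mul_le_mul_of_nonneg_right (by linarith) hE.le
    _ ≤ (log B - E * B * log B) * E := by gcongr
    _ = E * B * (1 - E * B) / B * log B := by field_simp
    _ ≤ (1 - exp (-(E * B))) / B * log B := by gcongr
    _ ≤ directCapacity E := directCapacity_ge hE hbdd hB1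

end KennedyDolinar

theorem theorem1 :
    ∃ K E₀ : ℝ, 0 < E₀ ∧ ∀ E : ℝ, 0 < E → E < E₀ →
      BddAbove (KennedyDolinar.coherentRates E) ∧
      KennedyDolinar.coherentCapacity E / E ≤
        Real.log (1 / E) - Real.log (Real.log (1 / E)) + K ∧
      Real.log (1 / E) - Real.log (Real.log (1 / E)) - K ≤
        KennedyDolinar.directCapacity E / E ∧
      KennedyDolinar.directCapacity E ≤ KennedyDolinar.coherentCapacity E := by
  refine ⟨400, Real.exp (-1), Real.exp_pos _, fun E hE hE1 => ?_⟩
  have hub := fun R hR => KennedyDolinar.le_of_mem_coherentRates (R := R) hE hE1 hR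
  have hbdd : BddAbove (KennedyDolinar.coherentRates E) := ⟨_, hub⟩
  have hsub := KennedyDolinar.directRates_subset_coherentRates E
  have h0 := KennedyDolinar.zero_mem_directRates hE
  refine ⟨hbdd, ?_, ?_, csSup_le_csSup hbdd ⟨0, h0⟩ hsub⟩
  · rw [div_le_iff₀ hE, mul_comm]
    exact csSup_le ⟨0, hsub h0⟩ hub
  · have := KennedyDolinar.directCapacity_div_ge hE hE1 (hbdd.mono hsub)
    linarith
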